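/- For a finite sequence $x=(x_1,\dots,x_n)$ of nonnegative integers let $\mathrm{asc}(x)=|\{1\le j<n : x_j<x_{j+1}\}|$ be its number of ascents. Call $x$ an ascent sequence of length $n$ if $x_1=0$ (when $n\ge 1$) and $0\le x_i\le 1+\mathrm{asc}(x_1,\dots,x_{i-1})$ for all $2\le i\le n$; the empty sequence is the only ascent sequence of length $0$. Let $$F(t;u,1)=\sum_{n\ge 0} t^n\sum_{x} u^{\mathrm{asc}(x)}\in\mathbb{Q}[u][[t]],$$ where the inner sum runs over the ascent sequences $x$ of length $n$, be the generating function of ascent sequences counted by length and number of ascents. For $n\ge 0$ consider the polynomial in $t$ and $u$ $$F_n(t;u)=\sum_{\ell=0}^n (u-1)^{n-\ell}u^\ell\sum_{m=\ell}^n(-1)^{n-m}\binom{n}{m}(1-t)^{m-\ell}\prod_{i=m-\ell+1}^{m}\bigl(1-(1-t)^i\bigr).$$ Then: 1. for every $n\ge 0$, $F_n(t;u)$ is a multiple of $t^n$ in $\mathbb{Q}[u][t]$; 2. $F(t;u,1)=\sum_{n\ge 0}F_n(t;u)$ as formal power series in $t$ with coefficients in $\mathbb{Q}[u]$; 3. for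 every $n\ge 0$, $F_n(t;1)=\prod_{i=1}^n\bigl(1-(1-t)^i\bigr)$; 4. consequently, the generating function of unlabeled $(\mathbf{2+2})$-free posets is $$\sum_{n\ge 0}p_n t^n=\sum_{n\ge 0}\ \prod_{i=1}^n\bigl(1-(1-t)^i\bigr),$$ where $p_n$ is the number of isomorphism classes of posets on $n$ elements that contain no induced subposet isomorphic to the disjoint union of two $2$-element chains. -/

import Mathlib

open scoped Polynomial PowerSeries

noncomputable section

/-- The number of ascents `asc(x_1, …, x_n) = |{1 ≤ j < n : x_j < x_{j+1}}|` of a finite sequence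
(indexed here by `0, …, n - 1`). -/
def numAscents {n : ℕ} (x : Fin n → ℕ) : ℕ :=
  (Finset.univ.filter fun j : Fin n => ∃ h : (j : ℕ) + 1 < n, x j < x ⟨(j : ℕ) + 1, h⟩).card

/-- `x` is an ascent sequence of length `n`: its first entry is `0`, and each later entry is at most
one more than the number of ascents of the sequence of the entries strictly before it. -/
def IsAscentSequence {n : ℕ} (x : Fin n → ℕ) : Prop :=
  ∀ i : Fin n, ((i : ℕ) = 0 → x i = 0) ∧
    (0 < (i : ℕ) → x i ≤ 1 + numAscents (Fin.take (i : ℕ) i.isLt.le x))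

theorem numAscents_le {n : ℕ} (x : Fin n → ℕ) : numAscents x ≤ n := by
  unfold numAscents
  exact (Finset.card_le_univ _).trans (by simp)

theorem finite_ascentSequences (n : ℕ) : {x : Fin n → ℕ | IsAscentSequence x}.Finite := by
  refine (Set.finite_Iic (fun _ : Fin n => 1 + n)).subset ?_
  intro x hx i
  rcases Nat.eq_zero_or_pos (i : ℕ) with h | h
  · rw [(hx i).1 h]
    exact Nat.zero_le _
  · have h1 := (hx i).2 h
    have h2 := numAscents_le (Fin.take (i : ℕ) i.isLt.le x)
    have h3 := i.isLt
    change x i ≤ 1 + n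
    omega

/-- The finite set of ascent sequences of length `n`. -/
def ascentSequences (n : ℕ) : Finset (Fin n → ℕ) := (finite_ascentSequences n).toFinset

/-- The generating function `F(t; u, 1)` of ascent sequences, counted by length (variable `t`) and
number of ascents (variable `u`), as a power series in `t` over `ℚ[u]`. The empty sequence is
counted. -/
def ascentGF : ℚ[X]⟦X⟧ :=
  PowerSeries.mk fun n => ∑ x ∈ ascentSequences n, (Polynomial.X : ℚ[X]) ^ numAscents x

/-- The polynomial `F_n(t; u)`, as a polynomial in `t` with coefficients in `ℚ[u]`. -/
def Fpoly (n : ℕ) : ℚ[X][X] :=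
  let t : ℚ[X][X] := Polynomial.X
  let u : ℚ[X][X] := Polynomial.C Polynomial.X
  ∑ l ∈ Finset.range (n + 1), (u - 1) ^ (n - l) * u ^ l *
    ∑ m ∈ Finset.Icc l n, (-1) ^ (n - m) * (n.choose m : ℚ[X][X]) * (1 - t) ^ (m - l) *
      ∏ i ∈ Finset.Icc (m - l + 1) m, (1 - (1 - t) ^ i)

open scoped PowerSeries.WithPiTopology in
/-- The series `∑ f_n` of formal power series converges to `S` for the usual topology of formal
power series (coefficientwise convergence, the ring of coefficients being discrete). -/
def HasFormalSum {R : Type*} [CommRing R] (f : ℕ → R⟦X⟧) (S : R⟦X⟧) : Prop :=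
  letI : TopologicalSpace R := ⊥
  HasSum f S

/-- A poset is `(2+2)`-free if it has no induced subposet isomorphic to the disjoint union of two
chains with two elements (`⊕` carries the order of the disjoint union). -/
def IsTwoPlusTwoFree (α : Type*) [PartialOrder α] : Prop :=
  IsEmpty ((Fin 2 ⊕ Fin 2) ↪o α)

/-- The `(2+2)`-free partial orders on the set `{0, …, n - 1}`. -/
def TwoPlusTwoFreeOrder (n : ℕ) : Type :=
  {P : PartialOrder (Fin n) // @IsTwoPlusTwoFree (Fin n) P}

/-- Isomorphism of posets. -/
def twoPlusTwoFreeSetoid (n : ℕ) : Setoid (TwoPlusTwoFreeOrder n) where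
  r P Q := Nonempty (@OrderIso (Fin n) (Fin n) P.1.toLE Q.1.toLE)
  iseqv :=
    { refl := fun P => ⟨@OrderIso.refl (Fin n) P.1.toLE⟩
      symm := fun {P Q} ⟨e⟩ => ⟨@OrderIso.symm (Fin n) (Fin n) P.1.toLE Q.1.toLE e⟩
      trans := fun {P Q R} ⟨e⟩ ⟨f⟩ =>
        ⟨@OrderIso.trans (Fin n) (Fin n) (Fin n) P.1.toLE Q.1.toLE R.1.toLE e f⟩ }

/-- The number of unlabeled `(2+2)`-free posets on `n` elements, that is, of isomorphism classes. -/
def numTwoPlusTwoFree (n : ℕ) : ℕ := Nat.card (Quotient (twoPlusTwoFreeSetoid n))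

/-- The generating function `P(t)` of unlabeled `(2+2)`-free posets, by number of elements. -/
def posetGF : ℚ⟦X⟧ := PowerSeries.mk fun n => (numTwoPlusTwoFree n : ℚ)

end

open scoped Polynomial PowerSeries

noncomputable section

/-! Write q = 1 - t, substitute u = 1/(1+s) and work in ℚ⟦t⟧⟦s⟧. As 1/(1+s) is transcendental over
ℚ, divisibility by t^N of polynomials in t and u can be tested after this substitution
(`X_pow_dvd_of_t_pow_dvd_specialize`). Times u, the N-term sums of F_n and of t^n A_n, where A_n
counts ascent sequences of length n by ascents, both satisfy (1+qs) G(s) - G(qs) = qs/(1+qs) modulo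
t^N. Modulo t the left side is s G(s), so the operator is injective modulo every power of t
(`t_pow_dvd_of_dvd_kernel`), and the two sums agree modulo t^N.

For F_n, the substitution gives u^n times a binomial transform of finite q-sums; the functional
equation of the q-sums yields one for the numerators (`kernel_mul_numer`), whence t^n ∣ F_n and the
equation for the sum. For ascent sequences the equation comes from the kernel method applied to the
last entry (`ascentLastSum_succ`).

For posets, a nonempty (2+2)-free order has exactly one representation by intervals in {0, …, a} in
which every point is both a left and a right endpoint. Isomorphism classes are therefore multisets
of such intervals. These grow by one interval at a time along the generating tree of ascent
sequences (`treeSum`): a plays the number of ascents, and the least left endpoint l of an interval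
ending at a plays the last entry. -/

namespace FishburnSeries

/-! ### Series in s over ℚ⟦t⟧ and the kernel equation -/

/-- The variable `t`, in the ring of power series in `s` over `ℚ⟦t⟧`. -/
def t : ℚ⟦X⟧⟦X⟧ := PowerSeries.C PowerSeries.X

/-- The variable `s`. -/
def s : ℚ⟦X⟧⟦X⟧ := PowerSeries.X

/-- The substitution `s ↦ (1 - t) s`. -/
def scale : ℚ⟦X⟧⟦X⟧ →+* ℚ⟦X⟧⟦X⟧ := PowerSeries.rescale (1 - PowerSeries.X)

/-- The series `1 / (1 + s)`. -/
def u : ℚ⟦X⟧⟦X⟧ := PowerSeries.mk fun n => (-1) ^ n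

/-- The series `1 / (1 + (1 - t) s)`. -/
def v : ℚ⟦X⟧⟦X⟧ := scale u

theorem scale_t : scale t = t := by
  ext1 n
  simp only [scale, t, PowerSeries.coeff_rescale, PowerSeries.coeff_C]
  split_ifs with h <;> simp [h]

theorem scale_s : scale s = (1 - t) * s := by
  simp [scale, s, t, PowerSeries.rescale_X]

theorem one_add_s_mul_u : (1 + s) * u = 1 := by
  ext1 n
  rw [add_mul, one_mul, map_add]
  rcases n with _ | n
  · simp [s, u]
  · simp [s, u, PowerSeries.coeff_succ_X_mul, PowerSeries.coeff_one, pow_succ]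

theorem one_add_scale_s_mul_v : (1 + (1 - t) * s) * v = 1 := by
  have h := congrArg scale one_add_s_mul_u
  simpa [scale_s, v] using h

theorem t_dvd_iff {P : ℚ⟦X⟧⟦X⟧} : t ∣ P ↔ ∀ k, PowerSeries.X ∣ PowerSeries.coeff k P := by
  constructor
  · rintro ⟨Q, rfl⟩ k
    simp [t, PowerSeries.coeff_C_mul]
  · intro h
    choose c hc using h
    refine ⟨PowerSeries.mk c, ?_⟩
    ext1 k
    simp [t, PowerSeries.coeff_C_mul, hc k]

theorem t_ne_zero : t ≠ 0 := by
  intro h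
  have := congrArg (fun P => PowerSeries.coeff 1 (PowerSeries.coeff 0 P)) h
  simp [t] at this

theorem t_dvd_scale_sub (P : ℚ⟦X⟧⟦X⟧) : t ∣ scale P - P := by
  rw [t_dvd_iff]
  intro k
  have h : (PowerSeries.X : ℚ⟦X⟧) ∣ (1 - PowerSeries.X) ^ k - 1 := by
    have := sub_dvd_pow_sub_pow (1 - PowerSeries.X : ℚ⟦X⟧) 1 k
    rw [one_pow] at this
    refine dvd_trans ?_ this
    exact ⟨-1, by ring⟩
  have e : PowerSeries.coeff k (scale P - P) =
      ((1 - PowerSeries.X) ^ k - 1) * PowerSeries.coeff k P := by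
    simp [scale, PowerSeries.coeff_rescale, sub_mul]
  rw [e]
  exact h.mul_right _

theorem t_dvd_of_t_dvd_s_mul {P : ℚ⟦X⟧⟦X⟧} (h : t ∣ s * P) : t ∣ P := by
  rw [t_dvd_iff] at h ⊢
  intro k
  simpa [s, PowerSeries.coeff_succ_X_mul] using h (k + 1)

/-- The equation `(1 + (1 - t) s) P(s) = P((1 - t) s)` has only the zero solution, modulo every power
of `t`. -/
theorem t_pow_dvd_of_dvd_kernel (n : ℕ) : ∀ P : ℚ⟦X⟧⟦X⟧,
    t ^ n ∣ (1 + (1 - t) * s) * P - scale P → t ^ n ∣ P := by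
  induction n with
  | zero => intro P _; simp
  | succ n ih =>
    intro P h
    obtain ⟨Q, rfl⟩ := ih P ((pow_dvd_pow t (Nat.le_succ n)).trans h)
    have e : (1 + (1 - t) * s) * (t ^ n * Q) - scale (t ^ n * Q) =
        t ^ n * ((1 + (1 - t) * s) * Q - scale Q) := by
      rw [map_mul, map_pow, scale_t]; ring
    rw [e, pow_succ] at h
    rw [pow_succ]
    -- s Q is the kernel expression of Q, plus Q(qs) - Q, plus t s Q; all three are divisible by t.
    refine mul_dvd_mul_left _ (t_dvd_of_t_dvd_s_mul ?_)
    have h1 := (mul_dvd_mul_iff_left (pow_ne_zero n t_ne_zero)).1 h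
    have h2 := (h1.add (t_dvd_scale_sub Q)).add (Dvd.intro (s * Q) rfl : t ∣ t * (s * Q))
    convert h2 using 1
    ring

/-! ### Finite q-sums and their binomial transforms -/

/-- The polynomials `∑ j ≤ m, (-q s) ^ j ∏ j < i ≤ m, (1 - q ^ i)`, where `q = 1 - t`. -/
def partialQSum : ℕ → ℚ⟦X⟧⟦X⟧
  | 0 => 1
  | m + 1 => (1 - (1 - t) ^ (m + 1)) * partialQSum m + (-((1 - t) * s)) ^ (m + 1)

theorem kernel_mul_partialQSum (m : ℕ) : (1 + (1 - t) * s) * partialQSum m =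
    scale (partialQSum m) - (-((1 - t) * s)) ^ (m + 1) := by
  induction m with
  | zero => simp [partialQSum]
  | succ m ih =>
    rw [partialQSum, mul_add, mul_left_comm, ih]
    simp only [map_add, map_mul, map_sub, map_one, map_pow, map_neg, scale_t, scale_s]
    have e : (-((1 - t) * ((1 - t) * s))) ^ (m + 1) =
        (1 - t) ^ (m + 1) * (-((1 - t) * s)) ^ (m + 1) := by
      rw [← mul_pow]; ring
    rw [e]
    ring

theorem partialQSum_eq_sum (m : ℕ) : partialQSum m = ∑ j ∈ Finset.range (m + 1),
    (-((1 - t) * s)) ^ j * ∏ i ∈ Finset.Icc (j + 1) m, (1 - (1 - t) ^ i) := by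
  induction m with
  | zero => simp [partialQSum]
  | succ m ih =>
    rw [Finset.sum_range_succ, partialQSum, ih, Finset.mul_sum]
    congr 1
    · refine Finset.sum_congr rfl fun j hj => ?_
      rw [Finset.prod_Icc_succ_top (by have := Finset.mem_range.1 hj; omega)]
      ring
    · simp

/-- The binomial transform of `a` with parameter `x`. -/
def binomTransform {A : Type*} [CommRing A] (a : ℕ → A) (x : A) (n : ℕ) : A :=
  ∑ m ∈ Finset.range (n + 1), (n.choose m : A) * x ^ (n - m) * a m

/-- Umbral form: the linear map X^m ↦ a m sends (X + x)^n to the transform. Composing transforms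
therefore adds their parameters. -/
theorem binomTransform_eq_lsum {A : Type*} [CommRing A] (a : ℕ → A) (x : A) (n : ℕ) :
    binomTransform a x n =
      Polynomial.lsum (fun m => LinearMap.mulRight A (a m)) ((Polynomial.X + Polynomial.C x) ^ n) := by
  rw [add_pow, map_sum]
  refine Finset.sum_congr rfl fun m _ => ?_
  have e : (Polynomial.X ^ m * Polynomial.C x ^ (n - m) * (n.choose m : A[X]) : A[X]) =
      Polynomial.monomial m ((n.choose m : A) * x ^ (n - m)) := by
    rw [← Polynomial.C_mul_X_pow_eq_monomial]
    simp only [map_mul, map_pow, map_natCast]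
    ring
  rw [e, Polynomial.lsum_apply, Polynomial.sum_monomial_index]
  · simp
  · simp

theorem binomTransform_binomTransform {A : Type*} [CommRing A] (a : ℕ → A) (x y : A) (n : ℕ) :
    binomTransform (binomTransform a x) y n = binomTransform a (x + y) n := by
  rw [binomTransform_eq_lsum a, Polynomial.C_add, ← add_assoc, add_pow, map_sum]
  refine Finset.sum_congr rfl fun m _ => ?_
  rw [binomTransform_eq_lsum a]
  have e : ((Polynomial.X + Polynomial.C x) ^ m * Polynomial.C y ^ (n - m) * (n.choose m : A[X]) : A[X])
      = ((n.choose m : A) * y ^ (n - m)) • (Polynomial.X + Polynomial.C x) ^ m := by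
    rw [Polynomial.smul_eq_C_mul]
    simp only [map_mul, map_pow, map_natCast]
    ring
  rw [e, map_smul, smul_eq_mul]

/-- The numerator of `F_n(t; 1 / (1 + s))` over `(1 + s) ^ n`. -/
def numer (n : ℕ) : ℚ⟦X⟧⟦X⟧ := binomTransform partialQSum s n

/-- Split the parameter as s = qs + ts: the transform by qs of the scaled q-sums is the scaled
numerator, leaving a transform by ts. The boundary terms of the q-sums add up to qs (s - qs)^n. -/
theorem kernel_mul_numer (n : ℕ) : (1 + (1 - t) * s) * numer n =
    binomTransform (fun k => scale (numer k)) (t * s) n + (1 - t) * s * (t * s) ^ n := by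
  have h1 : (fun k => scale (numer k)) =
      binomTransform (fun k => scale (partialQSum k)) ((1 - t) * s) := by
    funext k
    simp [numer, binomTransform, scale_s]
  rw [h1, binomTransform_binomTransform]
  have h2 : (t * s) ^ n = ∑ m ∈ Finset.range (n + 1),
      (n.choose m : ℚ⟦X⟧⟦X⟧) * s ^ (n - m) * (-((1 - t) * s)) ^ m := by
    rw [show t * s = -((1 - t) * s) + s by ring, add_pow]
    exact Finset.sum_congr rfl fun m _ => by ring
  rw [h2, numer, binomTransform, binomTransform, Finset.mul_sum, Finset.mul_sum,
    ← Finset.sum_add_distrib]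
  refine Finset.sum_congr rfl fun m _ => ?_
  rw [mul_left_comm, kernel_mul_partialQSum]
  ring

/-- In `kernel_mul_numer` the terms k < n carry t^(n-k) from the parameter and t^k by induction. The
term k = n is the scaled numerator itself, so the kernel expression vanishes modulo t^n. -/
theorem t_pow_dvd_numer (n : ℕ) : t ^ n ∣ numer n := by
  induction n using Nat.strong_induction_on with
  | _ n ih =>
    refine t_pow_dvd_of_dvd_kernel n _ ?_
    rw [kernel_mul_numer, binomTransform, Finset.sum_range_succ]
    have e : ∀ a : ℚ⟦X⟧⟦X⟧, a + (n.choose n : ℚ⟦X⟧⟦X⟧) * (t * s) ^ (n - n) * scale (numer n) +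
        (1 - t) * s * (t * s) ^ n - scale (numer n) = a + (1 - t) * s * s ^ n * t ^ n := by
      intro a
      rw [Nat.choose_self, Nat.sub_self, mul_pow]
      push_cast
      ring
    rw [e]
    refine dvd_add (Finset.dvd_sum fun k hk => ?_) (Dvd.intro_left _ rfl)
    have hk' := Finset.mem_range.1 hk
    obtain ⟨Q, hQ⟩ := ih k hk'
    rw [hQ, map_mul, map_pow, scale_t, mul_pow]
    refine ⟨(n.choose k : ℚ⟦X⟧⟦X⟧) * s ^ (n - k) * scale Q, ?_⟩
    rw [show t ^ n = t ^ (n - k) * t ^ k by rw [← pow_add]; congr 1; omega]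
    ring

/-! ### The functional equation of the sum of the F_n -/

/-- Truncated expansion of 1/(1-x)^(k+1), obtained from k by Pascal's rule. -/
theorem pow_dvd_one_sub_pow_mul_sum {A : Type*} [CommRing A] (x : A) (N : ℕ) (k : ℕ) :
    x ^ N ∣ (1 - x) ^ (k + 1) * (∑ i ∈ Finset.range N, ((k + i).choose k : A) * x ^ i) - 1 := by
  induction k with
  | zero =>
    have := mul_neg_geom_sum x N
    simp only [zero_add, pow_one, Nat.choose_zero_right, Nat.cast_one, one_mul]
    rw [this]
    exact ⟨-1, by ring⟩
  | succ k ih =>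
    have h : ∀ N : ℕ, (1 - x) * (∑ i ∈ Finset.range N, ((k + 1 + i).choose (k + 1) : A) * x ^ i) =
        (∑ i ∈ Finset.range N, ((k + i).choose k : A) * x ^ i) -
          ((k + N).choose (k + 1) : A) * x ^ N := by
      intro N
      induction N with
      | zero => simp
      | succ N ih =>
        rw [Finset.sum_range_succ, Finset.sum_range_succ, mul_add, ih,
          show k + 1 + N = (k + N) + 1 by ring, show k + (N + 1) = (k + N) + 1 by ring,
          Nat.choose_succ_succ]
        push_cast
        ring
    rw [pow_succ, mul_assoc, h, mul_sub, sub_right_comm]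
    exact dvd_sub ih ⟨(1 - x) ^ (k + 1) * ((k + N).choose (k + 1) : A), by ring⟩

theorem u_eq : u = (1 - u * (t * s)) * v := by
  have h1 := one_add_s_mul_u
  have h2 := one_add_scale_s_mul_v
  linear_combination (-u) * h2 + v * h1

/-- After interchanging the sums, the scaled numerator k has coefficient u^(k+1) times a truncation
of 1/(1-x)^(k+1) with x = uts. By `u_eq` this is v^(k+1) modulo t^(N-k), the precision needed since
numerator k is divisible by t^k. -/
theorem t_pow_dvd_kernel_sum_numer (N : ℕ) :
    t ^ N ∣ (1 + (1 - t) * s) * (u * ∑ n ∈ Finset.range N, u ^ n * numer n) -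
      scale (u * ∑ n ∈ Finset.range N, u ^ n * numer n) - (1 - t) * s * v := by
  set x := u * (t * s) with hx
  have h1 : (1 + (1 - t) * s) * (u * ∑ n ∈ Finset.range N, u ^ n * numer n) =
      ∑ k ∈ Finset.range N, scale (numer k) * (u ^ (k + 1) *
        ∑ i ∈ Finset.range (N - k), ((k + i).choose k : ℚ⟦X⟧⟦X⟧) * x ^ i) +
      (1 - t) * s * (u * ∑ n ∈ Finset.range N, x ^ n) := by
    have e : ∀ n, (1 + (1 - t) * s) * (u * (u ^ n * numer n)) =
        (∑ k ∈ Finset.range (n + 1), scale (numer k) * (u ^ (k + 1) *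
          ((n.choose k : ℚ⟦X⟧⟦X⟧) * x ^ (n - k)))) + (1 - t) * s * (u * x ^ n) := by
      intro n
      rw [mul_left_comm, mul_left_comm (1 + (1 - t) * s), kernel_mul_numer, binomTransform, hx,
        mul_pow, mul_add, mul_add, Finset.mul_sum, Finset.mul_sum]
      refine congrArg₂ (· + ·) ?_ ?_
      · refine Finset.sum_congr rfl fun k hk => ?_
        have hk' := Finset.mem_range.1 hk
        rw [show u ^ n = u ^ k * u ^ (n - k) by rw [← pow_add]; congr 1; omega]
        rw [mul_pow u]
        ring
      · ring
    rw [Finset.mul_sum, Finset.mul_sum, Finset.sum_congr rfl fun n _ => e n,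
      Finset.sum_add_distrib, Finset.mul_sum, Finset.mul_sum]
    refine congrArg₂ (· + ·) ?_ rfl
    simp_rw [Finset.mul_sum, Finset.range_eq_Ico]
    rw [Finset.sum_comm' (t' := Finset.Ico 0 N) (s' := fun k => Finset.Ico k N)
      (by intro a b; simp only [Finset.mem_Ico]; omega)]
    refine Finset.sum_congr rfl fun k _ => ?_
    rw [Finset.sum_Ico_eq_sum_range, ← Finset.range_eq_Ico]
    exact Finset.sum_congr rfl fun i _ => by rw [Nat.add_sub_cancel_left]
  have key : ∀ k ≤ N, t ^ (N - k) ∣ u ^ (k + 1) *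
      (∑ i ∈ Finset.range (N - k), ((k + i).choose k : ℚ⟦X⟧⟦X⟧) * x ^ i) - v ^ (k + 1) := by
    intro k _
    have h := pow_dvd_one_sub_pow_mul_sum x (N - k) k
    have hu : u ^ (k + 1) = v ^ (k + 1) * (1 - x) ^ (k + 1) := by
      rw [← mul_pow, mul_comm v, ← u_eq]
    rw [hu, mul_assoc, ← mul_sub_one]
    refine Dvd.dvd.mul_left (dvd_trans ?_ h) _
    rw [hx, mul_left_comm, mul_pow]
    exact Dvd.intro _ rfl
  have h2 : scale (u * ∑ n ∈ Finset.range N, u ^ n * numer n) =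
      ∑ k ∈ Finset.range N, scale (numer k) * v ^ (k + 1) := by
    rw [map_mul, map_sum, Finset.mul_sum]
    refine Finset.sum_congr rfl fun k _ => ?_
    rw [map_mul, map_pow, ← v]
    ring
  rw [h1, h2, add_sub_right_comm, ← Finset.sum_sub_distrib, add_sub_assoc, ← mul_sub]
  refine dvd_add (Finset.dvd_sum fun k hk => ?_) (Dvd.dvd.mul_left ?_ _)
  · have hk' := (Finset.mem_range.1 hk).le
    rw [← mul_sub, show t ^ N = t ^ k * t ^ (N - k) by rw [← pow_add]; congr 1; omega]
    refine mul_dvd_mul ?_ (key k hk')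
    obtain ⟨Q, hQ⟩ := t_pow_dvd_numer k
    rw [hQ, map_mul, map_pow, scale_t]
    exact Dvd.intro _ rfl
  · simpa using key 0 (Nat.zero_le _)

/-! ### Returning from s to u -/

/-- The specialization `u ↦ 1 / (1 + s)` of polynomials in `t` and `u`. -/
def specialize : ℚ[X][X] →+* ℚ⟦X⟧⟦X⟧ :=
  Polynomial.eval₂RingHom (Polynomial.aeval u : ℚ[X] →ₐ[ℚ] ℚ⟦X⟧⟦X⟧).toRingHom t

theorem specialize_X : specialize Polynomial.X = t := by simp [specialize]

theorem specialize_C (p : ℚ[X]) : specialize (Polynomial.C p) = Polynomial.aeval u p := by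
  simp [specialize]

/-- The constant term of 1/(1+s) is 1, so p has the root 1; cancelling the nonzero factor w - 1
lowers the degree. -/
theorem eq_zero_of_aeval_eq_zero {p : ℚ[X]}
    (h : Polynomial.aeval (PowerSeries.mk fun n => (-1) ^ n : ℚ⟦X⟧) p = 0) : p = 0 := by
  set w : ℚ⟦X⟧ := PowerSeries.mk fun n => (-1) ^ n
  by_contra hp
  induction hd : p.natDegree using Nat.strong_induction_on generalizing p with
  | _ d ih =>
    have hroot : p.IsRoot 1 := by
      have := congrArg (PowerSeries.constantCoeff (R := ℚ)) h
      rw [Polynomial.aeval_def, Polynomial.hom_eval₂] at this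
      have hw : PowerSeries.constantCoeff w = 1 := by simp [w]
      rw [hw, map_zero] at this
      have hc : (PowerSeries.constantCoeff (R := ℚ)).comp (algebraMap ℚ ℚ⟦X⟧) = RingHom.id ℚ :=
        Subsingleton.elim _ _
      rw [hc] at this
      exact this
    obtain ⟨g, hg⟩ := Polynomial.dvd_iff_isRoot.2 hroot
    have hg0 : g ≠ 0 := by rintro rfl; exact hp (by simpa using hg)
    have hw1 : w - 1 ≠ 0 := by
      intro hh
      have := congrArg (PowerSeries.coeff 1) hh
      simp [w, PowerSeries.coeff_one] at this
    rw [hg, map_mul] at h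
    have h' : Polynomial.aeval w g = 0 := by
      refine (mul_eq_zero.1 h).resolve_left ?_
      simpa using hw1
    refine ih g.natDegree ?_ h' hg0 rfl
    rw [← hd, hg, Polynomial.natDegree_mul (Polynomial.X_sub_C_ne_zero 1) hg0,
      Polynomial.natDegree_X_sub_C]
    omega

theorem X_pow_dvd_of_t_pow_dvd_specialize (N : ℕ) : ∀ p : ℚ[X][X],
    t ^ N ∣ specialize p → Polynomial.X ^ N ∣ p := by
  induction N with
  | zero => intro p _; simp
  | succ N ih =>
    intro p h
    have hX : Polynomial.X ∣ p := by
      rw [Polynomial.X_dvd_iff]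
      obtain ⟨Q, hQ⟩ := (dvd_pow_self t (Nat.succ_ne_zero N)).trans h
      -- Setting t = 0 leaves the constant coefficient of p, a polynomial in u, evaluated at
      -- 1/(1+s).
      have := congrArg (PowerSeries.map (PowerSeries.constantCoeff (R := ℚ))) hQ
      rw [map_mul] at this
      have ht : PowerSeries.map (PowerSeries.constantCoeff (R := ℚ)) t = 0 := by
        simp [t]
      rw [ht, zero_mul, ← Polynomial.divX_mul_X_add p, map_add, map_mul, map_add, map_mul,
        specialize_X, ht, mul_zero, zero_add, specialize_C, Polynomial.aeval_def,
        Polynomial.hom_eval₂] at this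
      apply eq_zero_of_aeval_eq_zero
      rw [Polynomial.aeval_def]
      convert this using 2
      · exact Subsingleton.elim _ _
      · ext n; simp [u]
    obtain ⟨g, rfl⟩ := hX
    rw [map_mul, specialize_X, pow_succ'] at h
    rw [pow_succ']
    exact mul_dvd_mul_left _ (ih g ((mul_dvd_mul_iff_left t_ne_zero).1 h))

theorem specialize_Fpoly (n : ℕ) : specialize (Fpoly n) = u ^ n * numer n := by
  have hu : u - 1 = -(s * u) := by linear_combination one_add_s_mul_u
  simp only [Fpoly, map_sum, map_mul, map_pow, map_sub, map_one, map_prod, map_neg, map_natCast,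
    specialize_X, specialize_C, Polynomial.aeval_X, hu]
  simp_rw [Finset.mul_sum]
  rw [Finset.sum_comm' (t' := Finset.range (n + 1)) (s' := fun m => Finset.range (m + 1))
      (by intro a b; simp only [Finset.mem_Icc, Finset.mem_range]; omega)]
  rw [numer, binomTransform, Finset.mul_sum]
  refine Finset.sum_congr rfl fun m hm => ?_
  -- The index of the q-sum is j = m - l, hence the reflection.
  rw [partialQSum_eq_sum, Finset.mul_sum, Finset.mul_sum,
    ← Finset.sum_range_reflect (n := m + 1)]
  refine Finset.sum_congr rfl fun l hl => ?_
  have hm' := Finset.mem_range.1 hm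
  have hl' := Finset.mem_range.1 hl
  obtain ⟨b, rfl⟩ : ∃ b, n = m + b := ⟨n - m, by omega⟩
  obtain ⟨c, rfl⟩ : ∃ c, m = l + c := ⟨m - l, by omega⟩
  rw [show l + c + 1 - 1 - l = c by omega, show l + c + b - c = l + b by omega,
    show l + c + b - (l + c) = b by omega, show l + c - c = l by omega]
  have e1 : (-1 : ℚ⟦X⟧⟦X⟧) ^ b * (-1) ^ b = 1 := by rw [← mul_pow]; simp
  rw [neg_pow (s * u), neg_pow ((1 - t) * s)]
  simp only [mul_pow, pow_add]
  linear_combination (((-1) ^ l * (s ^ l * s ^ b * (u ^ l * u ^ b)) * u ^ c *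
    ((l + c + b).choose (l + c) : ℚ⟦X⟧⟦X⟧) * (1 - t) ^ l *
      ∏ i ∈ Finset.Icc (l + 1) (l + c), (1 - (1 - t) ^ i))) * e1

end FishburnSeries

/-! ### Ascent sequences and their generating tree -/

theorem mem_ascentSequences {n : ℕ} {x : Fin n → ℕ} :
    x ∈ ascentSequences n ↔ IsAscentSequence x := by
  simp [ascentSequences]

theorem numAscents_succ_eq_sum {n : ℕ} (x : Fin (n + 1) → ℕ) :
    numAscents x = ∑ j : Fin n, if x j.castSucc < x j.succ then 1 else 0 := by
  rw [numAscents, Finset.card_filter, Fin.sum_univ_castSucc]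
  simp [Fin.succ]

theorem numAscents_snoc {n : ℕ} (x : Fin (n + 1) → ℕ) (m : ℕ) :
    numAscents (Fin.snoc x m : Fin (n + 2) → ℕ) =
      numAscents x + if x (Fin.last n) < m then 1 else 0 := by
  rw [numAscents_succ_eq_sum, numAscents_succ_eq_sum, Fin.sum_univ_castSucc]
  simp only [Fin.snoc_castSucc, Fin.succ_last, Fin.snoc_last, Fin.succ_castSucc]

theorem isAscentSequence_snoc {n : ℕ} (x : Fin (n + 1) → ℕ) (m : ℕ) :
    IsAscentSequence (Fin.snoc x m : Fin (n + 2) → ℕ) ↔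
      IsAscentSequence x ∧ m ≤ 1 + numAscents x := by
  have htake : ∀ (k : ℕ) (h : k ≤ n + 1) (h' : k ≤ n + 2),
      Fin.take k h' (Fin.snoc x m : Fin (n + 2) → ℕ) = Fin.take k h x := by
    intro k h h'
    funext j
    have e : Fin.castLE h' j = (Fin.castLE h j).castSucc := rfl
    simp only [Fin.take_apply, e, Fin.snoc_castSucc]
  unfold IsAscentSequence
  rw [Fin.forall_fin_succ']
  refine and_congr (forall_congr' fun i => ?_) ?_
  · have h := htake i i.isLt.le (i.castSucc).isLt.le
    simp only [Fin.snoc_castSucc, Fin.val_castSucc]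
    rw [h]
  · have h := htake (n + 1) le_rfl (Nat.le_succ _)
    simp only [Fin.snoc_last, Fin.val_last]
    rw [h]
    simp [Fin.take_eq_self]

theorem sum_ascentSequences_succ {A : Type*} [AddCommMonoid A] (g : ℕ → ℕ → A) (n : ℕ) :
    ∑ x ∈ ascentSequences (n + 2), g (numAscents x) (x (Fin.last _)) =
      ∑ x ∈ ascentSequences (n + 1), ∑ m ∈ Finset.range (numAscents x + 2),
        g (numAscents x + if x (Fin.last _) < m then 1 else 0) m := by
  rw [Finset.sum_sigma']
  symm
  refine Finset.sum_bij' (fun p _ => (Fin.snoc p.1 p.2 : Fin (n + 2) → ℕ))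
    (fun x _ => ⟨Fin.init x, x (Fin.last _)⟩) ?_ ?_ ?_ ?_ ?_
  · rintro ⟨x, m⟩ h
    simp only [Finset.mem_sigma, mem_ascentSequences, Finset.mem_range] at h
    rw [mem_ascentSequences, isAscentSequence_snoc]
    exact ⟨h.1, by dsimp only; omega⟩
  · intro x h
    rw [mem_ascentSequences, ← Fin.snoc_init_self x, isAscentSequence_snoc] at h
    simp only [Finset.mem_sigma, mem_ascentSequences, Finset.mem_range]
    exact ⟨h.1, by omega⟩
  · rintro ⟨x, m⟩ _
    simp
  · intro x _
    simp
  · rintro ⟨x, m⟩ _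
    simp only [numAscents_snoc, Fin.snoc_last]

theorem ascentSequences_zero : ascentSequences 0 = {Fin.elim0} := by
  ext x
  simp only [mem_ascentSequences, Finset.mem_singleton]
  exact ⟨fun _ => Subsingleton.elim _ _, fun _ i => i.elim0⟩

theorem ascentSequences_one : ascentSequences 1 = {fun _ => 0} := by
  ext x
  simp only [mem_ascentSequences, Finset.mem_singleton]
  constructor
  · intro h
    funext i
    rw [Subsingleton.elim i 0]
    exact (h 0).1 rfl
  · rintro rfl i
    exact ⟨fun _ => rfl, fun _ => Nat.zero_le _⟩

theorem numAscents_zero (x : Fin 0 → ℕ) : numAscents x = 0 := by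
  simp [numAscents]

theorem numAscents_one (x : Fin 1 → ℕ) : numAscents x = 0 := by
  simp [numAscents_succ_eq_sum]

theorem last_le_numAscents {n : ℕ} {x : Fin (n + 1) → ℕ} (hx : IsAscentSequence x) :
    x (Fin.last n) ≤ numAscents x := by
  induction n with
  | zero => exact ((hx 0).1 rfl).le.trans (Nat.zero_le _)
  | succ n ih =>
    rw [← Fin.snoc_init_self x] at hx ⊢
    rw [isAscentSequence_snoc] at hx
    rw [numAscents_snoc, Fin.snoc_last]
    have := ih hx.1
    split_ifs <;> omega

/-- The sum of `g a l` over the nodes `(a, l)` of height `n` of the generating tree in which `(0, 0)`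
is the root and each `(a, l)` has a child `(a, m)` for `m ≤ l` and `(a + 1, m)` for `l < m ≤ a + 1`. -/
def treeSum {A : Type*} [AddCommMonoid A] : ℕ → (ℕ → ℕ → A) → A
  | 0, g => g 0 0
  | n + 1, g =>
    treeSum n fun a l => ∑ m ∈ Finset.range (a + 2), g (a + if l < m then 1 else 0) m

theorem sum_ascentSequences_eq_treeSum {A : Type*} [AddCommMonoid A] (n : ℕ) :
    ∀ g : ℕ → ℕ → A, ∑ x ∈ ascentSequences (n + 1), g (numAscents x) (x (Fin.last _)) =
      treeSum n g := by
  induction n with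
  | zero => intro g; simp [ascentSequences_one, numAscents_one, treeSum]
  | succ n ih =>
    intro g
    rw [sum_ascentSequences_succ, treeSum, ← ih]

/-- Two geometric sums, cut at m = l; l ≤ a ensures that the cut lies in the range. -/
theorem sub_one_mul_sum_children {A : Type*} [CommRing A] (u V : A) {a l : ℕ} (h : l ≤ a) :
    (V - 1) * ∑ m ∈ Finset.range (a + 2), u ^ (a + if l < m then 1 else 0) * V ^ m =
      u ^ a * (V ^ (l + 1) * (1 - u) - 1 + u * V ^ (a + 2)) := by
  obtain ⟨d, rfl⟩ : ∃ d, a = l + d := ⟨a - l, by omega⟩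
  rw [show l + d + 2 = (l + 1) + (d + 1) by ring, Finset.sum_range_add]
  have e1 : ∑ m ∈ Finset.range (l + 1), u ^ (l + d + if l < m then 1 else 0) * V ^ m =
      u ^ (l + d) * ∑ m ∈ Finset.range (l + 1), V ^ m := by
    rw [Finset.mul_sum]
    refine Finset.sum_congr rfl fun m hm => ?_
    have := Finset.mem_range.1 hm
    rw [if_neg (by omega), add_zero]
  have e2 : ∑ m ∈ Finset.range (d + 1),
      u ^ (l + d + if l < l + 1 + m then 1 else 0) * V ^ (l + 1 + m) =
      u ^ (l + d + 1) * V ^ (l + 1) * ∑ m ∈ Finset.range (d + 1), V ^ m := by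
    rw [Finset.mul_sum]
    refine Finset.sum_congr rfl fun m _ => ?_
    rw [if_pos (by omega), pow_add V (l + 1) m]
    ring
  rw [e1, e2, mul_add]
  have h1 := geom_sum_mul V (l + 1)
  have h2 := geom_sum_mul V (d + 1)
  linear_combination u ^ (l + d) * h1 + u ^ (l + d + 1) * V ^ (l + 1) * h2

/-! ### The kernel method for ascent sequences -/

namespace FishburnSeries

/-- The polynomial counting ascent sequences of length `n` by ascents, at `1 / (1 + s)`. -/
def ascentSum (n : ℕ) : ℚ⟦X⟧⟦X⟧ := ∑ x ∈ ascentSequences n, u ^ numAscents x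

/-- The value of the last entry variable that cancels the kernel. -/
def kernelRoot : ℚ⟦X⟧⟦X⟧ := (1 + s) * v

/-- Ascent sequences of length `n + 1`, by ascents and last entry, at the root of the kernel. -/
def ascentLastSum (n : ℕ) : ℚ⟦X⟧⟦X⟧ :=
  ∑ x ∈ ascentSequences (n + 1), u ^ numAscents x * kernelRoot ^ x (Fin.last _)

theorem kernelRoot_sub_one : kernelRoot - 1 = t * kernelRoot * (1 - u) := by
  have h1 := one_add_s_mul_u
  have h2 := one_add_scale_s_mul_v
  rw [kernelRoot]
  linear_combination h2 + t * v * h1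

theorem u_mul_kernelRoot : u * kernelRoot = v := by
  rw [kernelRoot]
  linear_combination v * one_add_s_mul_u

/-- At V = `kernelRoot` one has V - 1 = tV(1-u), so after weighting by powers of t the two sums over
last entries will telescope. Also uV = v turns u^a V^a into the scaled u^a. -/
theorem ascentLastSum_succ (n : ℕ) : t * kernelRoot * (1 - u) * ascentLastSum (n + 1) =
    (1 - u) * kernelRoot * ascentLastSum n - ascentSum (n + 1) +
      v * kernelRoot * scale (ascentSum (n + 1)) := by
  rw [ascentLastSum, sum_ascentSequences_succ (fun a l => u ^ a * kernelRoot ^ l),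
    ← kernelRoot_sub_one, Finset.mul_sum, ascentLastSum, ascentSum, map_sum, Finset.mul_sum,
    Finset.mul_sum, ← Finset.sum_sub_distrib, ← Finset.sum_add_distrib]
  refine Finset.sum_congr rfl fun x hx => ?_
  rw [sub_one_mul_sum_children u kernelRoot (last_le_numAscents (mem_ascentSequences.1 hx)),
    map_pow, ← v, ← u_mul_kernelRoot]
  ring

theorem ascentLastSum_zero : ascentLastSum 0 = 1 := by
  simp [ascentLastSum, ascentSequences_one, numAscents_one]

theorem t_pow_dvd_kernel_sum_ascentSum (N : ℕ) :
    t ^ N ∣ (1 + (1 - t) * s) * (u * ∑ n ∈ Finset.range N, t ^ n * ascentSum n) -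
      scale (u * ∑ n ∈ Finset.range N, t ^ n * ascentSum n) - (1 - t) * s * v := by
  rcases N with _ | N
  · simp
  have h1 := one_add_s_mul_u
  have h2 := one_add_scale_s_mul_v
  have h0 : ascentSum 0 = 1 := by simp [ascentSum, ascentSequences_zero, numAscents_zero]
  set T := ∑ n ∈ Finset.range N, t ^ (n + 1) * ascentSum (n + 1) with hT
  have hsum : ∑ n ∈ Finset.range (N + 1), t ^ n * ascentSum n = 1 + T := by
    rw [Finset.sum_range_succ', h0]; ring
  have htel : T - v * kernelRoot * scale T =
      (1 - u) * kernelRoot * (t - t ^ (N + 1) * ascentLastSum N) := by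
    rw [hT]
    clear hT hsum
    clear T
    induction N with
    | zero => simp [ascentLastSum_zero]
    | succ N ih =>
      rw [Finset.sum_range_succ, map_add, map_mul scale (t ^ (N + 1)), map_pow, scale_t]
      linear_combination ih + t ^ (N + 1) * ascentLastSum_succ N
  have hk := u_mul_kernelRoot
  rw [hsum, map_mul, map_add, map_one, ← v]
  -- The remainder of the telescoping, multiplied by (1+qs)u and simplified by uV = v and (1+qs)v =
  -- 1.
  refine ⟨-((1 - u) * ascentLastSum N), ?_⟩
  linear_combination ((1 + (1 - t) * s) * u) * htel +
    ((1 + (1 - t) * s) * (v * scale T + (1 - u) * (t - t ^ (N + 1) * ascentLastSum N))) * hk +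
    (v * scale T + (1 - u) * (t - t ^ (N + 1) * ascentLastSum N) - 1) * h2 + (1 - t) * h1

theorem t_pow_dvd_sum_ascentSum_sub (N : ℕ) :
    t ^ N ∣ (∑ n ∈ Finset.range N, t ^ n * ascentSum n) -
      ∑ n ∈ Finset.range N, u ^ n * numer n := by
  have h := dvd_sub (t_pow_dvd_kernel_sum_ascentSum N) (t_pow_dvd_kernel_sum_numer N)
  have h' : t ^ N ∣ u * ((∑ n ∈ Finset.range N, t ^ n * ascentSum n) -
      ∑ n ∈ Finset.range N, u ^ n * numer n) := by
    apply t_pow_dvd_of_dvd_kernel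
    rw [mul_sub u, map_sub]
    convert h using 1
    ring
  have h3 := Dvd.dvd.mul_left h' (1 + s)
  rwa [← mul_assoc, one_add_s_mul_u, one_mul] at h3

end FishburnSeries

/-! ### Divisibility, the formal sum, and the value at u = 1 -/

theorem X_pow_dvd_Fpoly (n : ℕ) : (Polynomial.X : ℚ[X][X]) ^ n ∣ Fpoly n := by
  apply FishburnSeries.X_pow_dvd_of_t_pow_dvd_specialize
  rw [FishburnSeries.specialize_Fpoly]
  exact (FishburnSeries.t_pow_dvd_numer n).mul_left _

theorem coeff_sum_Fpoly (d : ℕ) : ∑ n ∈ Finset.range (d + 1), (Fpoly n).coeff d =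
    ∑ x ∈ ascentSequences d, (Polynomial.X : ℚ[X]) ^ numAscents x := by
  have h : (Polynomial.X : ℚ[X][X]) ^ (d + 1) ∣
      (∑ n ∈ Finset.range (d + 1), Polynomial.X ^ n *
        Polynomial.C (∑ x ∈ ascentSequences n, (Polynomial.X : ℚ[X]) ^ numAscents x)) -
      ∑ n ∈ Finset.range (d + 1), Fpoly n := by
    apply FishburnSeries.X_pow_dvd_of_t_pow_dvd_specialize
    have := FishburnSeries.t_pow_dvd_sum_ascentSum_sub (d + 1)
    simp only [map_sub, map_sum, map_mul, map_pow, FishburnSeries.specialize_X,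
      FishburnSeries.specialize_C, FishburnSeries.specialize_Fpoly, Polynomial.aeval_X]
    exact this
  have hd := Polynomial.X_pow_dvd_iff.1 h d (Nat.lt_succ_self d)
  rw [Polynomial.coeff_sub, Polynomial.finsetSum_coeff, Polynomial.finsetSum_coeff,
    Finset.sum_eq_single d, sub_eq_zero] at hd
  · rw [← hd, mul_comm, Polynomial.coeff_C_mul_X_pow, if_pos rfl]
  · intro n _ hn
    rw [mul_comm, Polynomial.coeff_C_mul_X_pow, if_neg (Ne.symm hn)]
  · intro hn
    simp at hn

open scoped PowerSeries.WithPiTopology in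
theorem hasFormalSum_of_coeff {R : Type*} [CommRing R] {f : ℕ → R⟦X⟧} {S : R⟦X⟧}
    (hf : ∀ n d, d < n → PowerSeries.coeff d (f n) = 0)
    (hS : ∀ d, ∑ n ∈ Finset.range (d + 1), PowerSeries.coeff d (f n) = PowerSeries.coeff d S) :
    HasFormalSum f S := by
  let _ : TopologicalSpace R := ⊥
  change HasSum f S
  rw [PowerSeries.WithPiTopology.hasSum_iff_hasSum_coeff]
  intro d
  rw [← hS d]
  refine hasSum_sum_of_ne_finset_zero fun n hn => hf n d ?_
  simpa using hn

theorem hasFormalSum_Fpoly : HasFormalSum (fun n : ℕ => (Fpoly n : ℚ[X]⟦X⟧)) ascentGF := by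
  refine hasFormalSum_of_coeff (fun n d hd => ?_) fun d => ?_
  · rw [Polynomial.coeff_coe]
    exact Polynomial.X_pow_dvd_iff.1 (X_pow_dvd_Fpoly n) d hd
  · simp only [Polynomial.coeff_coe, ascentGF, PowerSeries.coeff_mk]
    exact coeff_sum_Fpoly d

theorem Fpoly_map_eval_one (n : ℕ) : (Fpoly n).map (Polynomial.evalRingHom (1 : ℚ)) =
    ∏ i ∈ Finset.Icc 1 n, (1 - (1 - (Polynomial.X : ℚ[X])) ^ i) := by
  -- At u = 1 the factor (u-1)^(n-l) leaves only l = n, which forces m = n.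
  rw [Fpoly, Polynomial.map_sum, Finset.sum_eq_single n]
  · simp [Polynomial.map_prod]
  · intro l hl hln
    have := Finset.mem_range.1 hl
    rw [Polynomial.map_mul, Polynomial.map_mul, Polynomial.map_pow]
    simp [show n - l ≠ 0 by omega]
  · simp

theorem hasFormalSum_prod {S : ℚ⟦X⟧}
    (h : ∀ n, PowerSeries.coeff n S = ((ascentSequences n).card : ℚ)) :
    HasFormalSum
      (fun n : ℕ => ∏ i ∈ Finset.Icc 1 n, (1 - (1 - (PowerSeries.X : ℚ⟦X⟧)) ^ i)) S := by
  have hcoe : ∀ n d : ℕ,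
      PowerSeries.coeff d (∏ i ∈ Finset.Icc 1 n, (1 - (1 - (PowerSeries.X : ℚ⟦X⟧)) ^ i)) =
        ((Fpoly n).coeff d).eval 1 := by
    intro n d
    have e : (∏ i ∈ Finset.Icc 1 n, (1 - (1 - (PowerSeries.X : ℚ⟦X⟧)) ^ i)) =
        Polynomial.coeToPowerSeries.ringHom
          (∏ i ∈ Finset.Icc 1 n, (1 - (1 - (Polynomial.X : ℚ[X])) ^ i)) := by
      rw [map_prod]
      simp
    rw [e, ← Fpoly_map_eval_one]
    simp [Polynomial.coeff_coe]
  refine hasFormalSum_of_coeff (fun n d hd => ?_) fun d => ?_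
  · rw [hcoe, Polynomial.X_pow_dvd_iff.1 (X_pow_dvd_Fpoly n) d hd, Polynomial.eval_zero]
  · simp only [hcoe]
    rw [← Polynomial.eval_finsetSum, coeff_sum_Fpoly, h]
    simp [Polynomial.eval_finsetSum]

/-! ### Fishburn multisets grow along the same tree -/

/-- A multiset of pairs `i ≤ j ≤ a` in which each of `0, …, a` occurs as a first and as a second
component, and `l` is the least first component of a pair with second component `a`. (Equivalently,
an upper triangular matrix of size `a + 1` of natural numbers, without zero rows or columns.) -/
structure IsFishburn (M : Multiset (ℕ × ℕ)) (a l : ℕ) : Prop where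
  fst_le_snd : ∀ p ∈ M, p.1 ≤ p.2
  snd_le : ∀ p ∈ M, p.2 ≤ a
  exists_fst : ∀ i ≤ a, ∃ p ∈ M, p.1 = i
  exists_snd : ∀ j ≤ a, ∃ p ∈ M, p.2 = j
  mem : (l, a) ∈ M
  le_of_mem : ∀ i, (i, a) ∈ M → l ≤ i

namespace IsFishburn

variable {M : Multiset (ℕ × ℕ)} {a l : ℕ}

theorem le (h : IsFishburn M a l) : l ≤ a := h.fst_le_snd _ h.mem

theorem last_mem (h : IsFishburn M a l) : (a, a) ∈ M := by
  obtain ⟨⟨i, j⟩, hp, rfl⟩ := h.exists_fst a le_rfl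
  have h1 := h.fst_le_snd _ hp
  have h2 := h.snd_le _ hp
  obtain rfl : j = i := le_antisymm h2 h1
  exact hp

theorem unique {a' l' : ℕ} (h : IsFishburn M a l) (h' : IsFishburn M a' l') :
    a = a' ∧ l = l' := by
  obtain rfl : a = a' := le_antisymm (h'.snd_le _ h.mem) (h.snd_le _ h'.mem)
  exact ⟨rfl, le_antisymm (h.le_of_mem _ h'.mem) (h'.le_of_mem _ h.mem)⟩

end IsFishburn

theorem exists_isFishburn {M : Multiset (ℕ × ℕ)} {a : ℕ} (h1 : ∀ p ∈ M, p.1 ≤ p.2 ∧ p.2 ≤ a)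
    (h2 : ∀ i ≤ a, ∃ p ∈ M, p.1 = i) (h3 : ∀ j ≤ a, ∃ p ∈ M, p.2 = j) :
    ∃ l, IsFishburn M a l := by
  classical
  have hex : ∃ i, (i, a) ∈ M := by
    obtain ⟨⟨i, j⟩, hp, rfl⟩ := h3 a le_rfl
    exact ⟨i, hp⟩
  exact ⟨Nat.find hex, fun p hp => (h1 p hp).1, fun p hp => (h1 p hp).2, h2, h3,
    Nat.find_spec hex, fun i hi => Nat.find_min' hex hi⟩

/-- The relabelling of pairs under insertion of a new row `m`: the part of the column `a` above row
`m` becomes a new column `m - 1`. -/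
def splitColumn (a m : ℕ) (p : ℕ × ℕ) : ℕ × ℕ :=
  (if p.1 < m then p.1 else p.1 + 1,
    if p.2 < m - 1 then p.2 else if p.2 = a then (if p.1 < m then m - 1 else a + 1) else p.2 + 1)

/-- The inverse of `splitColumn`. -/
def mergeColumn (a m : ℕ) (p : ℕ × ℕ) : ℕ × ℕ :=
  (if p.1 < m then p.1 else p.1 - 1,
    if p.2 < m - 1 then p.2 else if p.2 = m - 1 then a else p.2 - 1)

theorem splitColumn_injective (a m : ℕ) :
    Function.Injective (splitColumn a m) := by
  rintro ⟨i, j⟩ ⟨i', j'⟩ e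
  simp only [splitColumn, Prod.mk.injEq] at e ⊢
  obtain ⟨e1, e2⟩ := e
  have hi : i = i' := by split_ifs at e1 <;> omega
  subst hi
  refine ⟨rfl, ?_⟩
  split_ifs at e2 <;> omega

theorem splitColumn_mergeColumn {a l i j : ℕ} (hl : 1 ≤ l) (hla : l ≤ a + 1) (hi : i ≠ l)
    (hij : i ≤ j) (hj : j ≤ a + 1) (hlast : j = a + 1 → l < i) :
    splitColumn a l (mergeColumn a l (i, j)) = (i, j) := by
  simp only [splitColumn, mergeColumn, Prod.mk.injEq]
  constructor <;> split_ifs <;> omega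

/-- A triple `(M, a, l)` with a Fishburn multiset `M`. -/
abbrev FishburnTriple := Multiset (ℕ × ℕ) × ℕ × ℕ

/-- The child with label `m` of a Fishburn multiset. -/
def fishburnChild (T : FishburnTriple) (m : ℕ) : FishburnTriple :=
  if T.2.2 < m then ((m, T.2.1 + 1) ::ₘ T.1.map (splitColumn T.2.1 m), T.2.1 + 1, m)
  else ((m, T.2.1) ::ₘ T.1, T.2.1, m)

theorem IsFishburn.cons {M : Multiset (ℕ × ℕ)} {a l m : ℕ} (h : IsFishburn M a l) (hm : m ≤ l) :
    IsFishburn ((m, a) ::ₘ M) a m where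
  fst_le_snd p hp := by
    rcases Multiset.mem_cons.1 hp with rfl | hp
    · exact hm.trans h.le
    · exact h.fst_le_snd p hp
  snd_le p hp := by
    rcases Multiset.mem_cons.1 hp with rfl | hp
    · exact le_rfl
    · exact h.snd_le p hp
  exists_fst i hi := by
    obtain ⟨p, hp, e⟩ := h.exists_fst i hi
    exact ⟨p, Multiset.mem_cons_of_mem hp, e⟩
  exists_snd j hj := by
    obtain ⟨p, hp, e⟩ := h.exists_snd j hj
    exact ⟨p, Multiset.mem_cons_of_mem hp, e⟩
  mem := Multiset.mem_cons_self _ _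
  le_of_mem i hi := by
    rcases Multiset.mem_cons.1 hi with hi | hi
    · exact (Prod.mk.inj hi).1.ge
    · exact hm.trans (h.le_of_mem i hi)

/-- The new pair fills row m and column a + 1; column m - 1 is filled by the image of (l, a),
because l < m. -/
theorem IsFishburn.cons_map_splitColumn {M : Multiset (ℕ × ℕ)} {a l m : ℕ} (h : IsFishburn M a l)
    (hlm : l < m) (hm : m ≤ a + 1) :
    IsFishburn ((m, a + 1) ::ₘ M.map (splitColumn a m)) (a + 1) m where
  fst_le_snd p hp := by
    rcases Multiset.mem_cons.1 hp with rfl | hp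
    · exact hm
    · obtain ⟨⟨i, j⟩, hq, rfl⟩ := Multiset.mem_map.1 hp
      have h1 := h.fst_le_snd _ hq
      have h2 := h.snd_le _ hq
      simp only [splitColumn] at *
      split_ifs <;> omega
  snd_le p hp := by
    rcases Multiset.mem_cons.1 hp with rfl | hp
    · exact le_rfl
    · obtain ⟨⟨i, j⟩, hq, rfl⟩ := Multiset.mem_map.1 hp
      have h1 := h.fst_le_snd _ hq
      have h2 := h.snd_le _ hq
      simp only [splitColumn] at *
      split_ifs <;> omega
  exists_fst i hi := by
    rcases lt_trichotomy i m with him | rfl | him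
    · obtain ⟨p, hp, e⟩ := h.exists_fst i (by omega)
      refine ⟨_, Multiset.mem_cons_of_mem (Multiset.mem_map_of_mem _ hp), ?_⟩
      simp [splitColumn, e, him]
    · exact ⟨_, Multiset.mem_cons_self _ _, rfl⟩
    · obtain ⟨p, hp, e⟩ := h.exists_fst (i - 1) (by omega)
      refine ⟨_, Multiset.mem_cons_of_mem (Multiset.mem_map_of_mem _ hp), ?_⟩
      simp only [splitColumn, e]
      split_ifs <;> omega
  exists_snd j hj := by
    rcases eq_or_ne j (a + 1) with rfl | hja
    · exact ⟨_, Multiset.mem_cons_self _ _, rfl⟩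
    rcases lt_trichotomy j (m - 1) with hjm | rfl | hjm
    · obtain ⟨p, hp, e⟩ := h.exists_snd j (by omega)
      refine ⟨_, Multiset.mem_cons_of_mem (Multiset.mem_map_of_mem _ hp), ?_⟩
      simp [splitColumn, e, hjm]
    · refine ⟨_, Multiset.mem_cons_of_mem (Multiset.mem_map_of_mem _ h.mem), ?_⟩
      simp only [splitColumn]
      split_ifs <;> omega
    · obtain ⟨p, hp, e⟩ := h.exists_snd (j - 1) (by omega)
      refine ⟨_, Multiset.mem_cons_of_mem (Multiset.mem_map_of_mem _ hp), ?_⟩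
      simp only [splitColumn, e]
      split_ifs <;> omega
  mem := Multiset.mem_cons_self _ _
  le_of_mem i hi := by
    rcases Multiset.mem_cons.1 hi with hi | hi
    · exact (Prod.mk.inj hi).1.ge
    · obtain ⟨⟨i', j'⟩, hq, e⟩ := Multiset.mem_map.1 hi
      have h2 := h.snd_le _ hq
      simp only [splitColumn, Prod.mk.injEq] at e h2
      obtain ⟨e1, e2⟩ := e
      split_ifs at e1 e2 <;> omega

theorem IsFishburn.child {T : FishburnTriple} {m : ℕ} (h : IsFishburn T.1 T.2.1 T.2.2)
    (hm : m < T.2.1 + 2) :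
    IsFishburn (fishburnChild T m).1 (fishburnChild T m).2.1 (fishburnChild T m).2.2 := by
  unfold fishburnChild
  split_ifs with hl
  · exact h.cons_map_splitColumn hl (by omega)
  · exact h.cons (by omega)

theorem card_fishburnChild (T : FishburnTriple) (m : ℕ) :
    Multiset.card (fishburnChild T m).1 = Multiset.card T.1 + 1 := by
  unfold fishburnChild
  split_ifs <;> simp

/-- Separates the two kinds of children: without the added pair, row m is empty in the split image
but occupied in M'. -/
theorem cons_map_splitColumn_ne_cons {M M' : Multiset (ℕ × ℕ)} {a a' m l' : ℕ}
    (hm : m ≤ l') (h' : IsFishburn M' a' l') :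
    (m, a + 1) ::ₘ M.map (splitColumn a m) ≠ (m, a') ::ₘ M' ∨ a + 1 ≠ a' := by
  by_contra! hc
  obtain ⟨hc, rfl⟩ := hc
  rw [Multiset.cons_inj_right] at hc
  obtain ⟨p, hp, e⟩ := h'.exists_fst m (hm.trans h'.le)
  rw [← hc] at hp
  obtain ⟨q, -, rfl⟩ := Multiset.mem_map.1 hp
  simp only [splitColumn] at e
  split_ifs at e <;> omega

theorem fishburnChild_inj {T T' : FishburnTriple} {m m' : ℕ} (h : IsFishburn T.1 T.2.1 T.2.2)
    (h' : IsFishburn T'.1 T'.2.1 T'.2.2) (e : fishburnChild T m = fishburnChild T' m') : T = T' ∧ m = m' := by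
  obtain ⟨M, a, l⟩ := T
  obtain ⟨M', a', l'⟩ := T'
  unfold fishburnChild at e
  dsimp only at *
  split_ifs at e with h1 h2 h2 <;> simp only [Prod.mk.injEq] at e <;>
    obtain ⟨eM, ea, rfl⟩ := e
  · obtain rfl : a = a' := by omega
    rw [Multiset.cons_inj_right] at eM
    obtain rfl := Multiset.map_injective (splitColumn_injective _ _) eM
    obtain ⟨-, rfl⟩ := h.unique h'
    exact ⟨rfl, rfl⟩
  · exact absurd ea ((cons_map_splitColumn_ne_cons (not_lt.1 h2) h').resolve_left (by simpa using eM))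
  · exact absurd ea.symm
      ((cons_map_splitColumn_ne_cons (not_lt.1 h1) h).resolve_left (by simpa using eM.symm))
  · subst ea
    rw [Multiset.cons_inj_right] at eM
    subst eM
    obtain ⟨-, rfl⟩ := h.unique h'
    exact ⟨rfl, rfl⟩

/-- Remove one copy of (l, a). If row l stays occupied, the rest is the parent. Otherwise delete row
l and merge column l - 1 into the last column. -/
theorem IsFishburn.exists_parent {M : Multiset (ℕ × ℕ)} {a l : ℕ} (h : IsFishburn M a l)
    (hcard : 2 ≤ Multiset.card M) : ∃ T : FishburnTriple, IsFishburn T.1 T.2.1 T.2.2 ∧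
      l < T.2.1 + 2 ∧ fishburnChild T l = (M, a, l) := by
  obtain ⟨E, rfl⟩ := Multiset.exists_cons_of_mem h.mem
  have hE : ∀ p, p ∈ (l, a) ::ₘ E → p ≠ (l, a) → p ∈ E := fun p hp hne =>
    (Multiset.mem_cons.1 hp).resolve_left hne
  by_cases hrow : ∃ p ∈ E, p.1 = l
  · have haa : (a, a) ∈ E := by
      rcases eq_or_ne l a with rfl | hla
      · obtain ⟨⟨i, j⟩, hp, rfl⟩ := hrow
        have h1 := h.fst_le_snd _ (Multiset.mem_cons_of_mem hp)
        have h2 := h.snd_le _ (Multiset.mem_cons_of_mem hp)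
        obtain rfl : j = i := le_antisymm h2 h1
        exact hp
      · exact hE _ h.last_mem fun e => hla (Prod.mk.inj e).1.symm
    obtain ⟨l', hl'⟩ : ∃ l', IsFishburn E a l' := by
      refine exists_isFishburn (fun p hp => ⟨h.fst_le_snd _ (Multiset.mem_cons_of_mem hp),
        h.snd_le _ (Multiset.mem_cons_of_mem hp)⟩) (fun i hi => ?_) fun j hj => ?_
      · rcases eq_or_ne i l with rfl | hil
        · exact hrow
        · obtain ⟨p, hp, e⟩ := h.exists_fst i hi
          exact ⟨p, hE p hp (by rintro rfl; exact hil e.symm), e⟩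
      · rcases eq_or_ne j a with rfl | hja
        · exact ⟨_, haa, rfl⟩
        · obtain ⟨p, hp, e⟩ := h.exists_snd j hj
          exact ⟨p, hE p hp (by rintro rfl; exact hja e.symm), e⟩
    have hll : l ≤ l' := h.le_of_mem l' (Multiset.mem_cons_of_mem hl'.mem)
    refine ⟨(E, a, l'), hl', ?_, ?_⟩
    · have := h.le; dsimp only; omega
    · simp [fishburnChild, not_lt.2 hll]
  · push Not at hrow
    -- Column 0 can contain only (0, 0). If l = 0, either this pair survives in E or a = 0 and every
    -- other pair is (0, 0); both contradict the emptiness of row 0.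
    have hl : 1 ≤ l := by
      by_contra! hl
      obtain rfl : l = 0 := by omega
      obtain ⟨⟨i, j⟩, hp, rfl⟩ := h.exists_snd 0 (Nat.zero_le _)
      have h1 := h.fst_le_snd _ hp
      obtain rfl : i = 0 := Nat.le_zero.1 h1
      rcases eq_or_ne a 0 with rfl | ha
      · rw [Multiset.card_cons] at hcard
        obtain ⟨q, hq⟩ := Multiset.card_pos_iff_exists_mem.1 (show 0 < Multiset.card E by omega)
        have h2 := h.fst_le_snd _ (Multiset.mem_cons_of_mem hq)
        have h3 := h.snd_le _ (Multiset.mem_cons_of_mem hq)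
        exact hrow q hq (by omega)
      · exact hrow _ (hE _ hp fun e => ha (Prod.mk.inj e).2.symm) rfl
    have hla := h.le
    obtain ⟨b, rfl⟩ : ∃ b, a = b + 1 := ⟨a - 1, by omega⟩
    have hEp : ∀ p ∈ E, p.1 ≠ l ∧ p.1 ≤ p.2 ∧ p.2 ≤ b + 1 ∧ (p.2 = b + 1 → l < p.1) := by
      intro p hp
      have hp' : p ∈ (l, b + 1) ::ₘ E := Multiset.mem_cons_of_mem hp
      refine ⟨hrow p hp, h.fst_le_snd p hp', h.snd_le p hp', fun e => ?_⟩
      have := h.le_of_mem p.1 (by rwa [show (p.1, b + 1) = p from Prod.ext rfl e.symm])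
      exact lt_of_le_of_ne this (hrow p hp).symm
    have hsplit : (E.map (mergeColumn b l)).map (splitColumn b l) = E := by
      rw [Multiset.map_map]
      refine (Multiset.map_congr rfl fun p hp => ?_).trans (Multiset.map_id E)
      obtain ⟨h1, h2, h3, h4⟩ := hEp p hp
      exact splitColumn_mergeColumn hl hla h1 h2 h3 h4
    -- A pair of column l - 1 merges into the last column with row i₀ < l. So the parent's label is
    -- below l, and the child l is the one with a split.
    obtain ⟨⟨i₀, j₀⟩, hp₀, e₀⟩ := h.exists_snd (l - 1) (by omega)
    have hp₀' := hE _ hp₀ (fun e => by have := (Prod.mk.inj e).2; simp only at e₀; omega)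
    have hm₀ := Multiset.mem_map_of_mem (mergeColumn b l) hp₀'
    have hi₀ := (hEp _ hp₀').2.1
    simp only at e₀ hi₀
    have hm₀' : mergeColumn b l (i₀, j₀) = (i₀, b) := by
      simp only [mergeColumn, Prod.mk.injEq]
      constructor <;> split_ifs <;> omega
    rw [hm₀'] at hm₀
    obtain ⟨l', hl'⟩ : ∃ l', IsFishburn (E.map (mergeColumn b l)) b l' := by
      refine exists_isFishburn (fun p hp => ?_) (fun i hi => ?_) fun j hj => ?_
      · obtain ⟨⟨i, j⟩, hq, rfl⟩ := Multiset.mem_map.1 hp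
        obtain ⟨h1, h2, h3, h4⟩ := hEp _ hq
        simp only [mergeColumn] at *
        constructor <;> split_ifs <;> omega
      · by_cases hil : i < l
        · obtain ⟨p, hp, e⟩ := h.exists_fst i (by omega)
          refine ⟨_, Multiset.mem_map_of_mem _ (hE p hp ?_), ?_⟩
          · rintro rfl
            simp only at e
            omega
          · simp [mergeColumn, e, hil]
        · obtain ⟨p, hp, e⟩ := h.exists_fst (i + 1) (by omega)
          refine ⟨_, Multiset.mem_map_of_mem _ (hE p hp ?_), ?_⟩
          · rintro rfl
            simp only at e
            omega
          · simp only [mergeColumn, e]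
            split_ifs <;> omega
      · rcases eq_or_ne j b with rfl | hjb
        · exact ⟨_, hm₀, rfl⟩
        by_cases hjl : j < l - 1
        · obtain ⟨p, hp, e⟩ := h.exists_snd j (by omega)
          refine ⟨_, Multiset.mem_map_of_mem _ (hE p hp ?_), ?_⟩
          · rintro rfl
            simp only at e
            omega
          · simp [mergeColumn, e, hjl]
        · obtain ⟨p, hp, e⟩ := h.exists_snd (j + 1) (by omega)
          refine ⟨_, Multiset.mem_map_of_mem _ (hE p hp ?_), ?_⟩
          · rintro rfl
            simp only at e
            omega
          · simp only [mergeColumn, e]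
            split_ifs <;> omega
    have hll : l' < l := by
      have := hl'.le_of_mem _ hm₀
      omega
    refine ⟨(E.map (mergeColumn b l), b, l'), hl', by dsimp only; omega, ?_⟩
    simp only [fishburnChild, if_pos hll, hsplit]

/-- The triples `(M, a, l)` with a Fishburn multiset `M` of `n + 1` pairs. -/
def fishburnTriples : ℕ → Finset FishburnTriple
  | 0 => {({(0, 0)}, 0, 0)}
  | n + 1 => (fishburnTriples n).biUnion fun T =>
      (Finset.range (T.2.1 + 2)).image (fishburnChild T)

theorem isFishburn_singleton : IsFishburn {(0, 0)} 0 0 where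
  fst_le_snd := by simp
  snd_le := by simp
  exists_fst := by simp
  exists_snd := by simp
  mem := by simp
  le_of_mem := by simp

theorem mem_fishburnTriples {n : ℕ} {T : FishburnTriple} : T ∈ fishburnTriples n ↔
    IsFishburn T.1 T.2.1 T.2.2 ∧ Multiset.card T.1 = n + 1 := by
  induction n generalizing T with
  | zero =>
    simp only [fishburnTriples, Finset.mem_singleton]
    constructor
    · rintro rfl
      exact ⟨isFishburn_singleton, rfl⟩
    · rintro ⟨h, hc⟩
      obtain ⟨M, a, l⟩ := T
      dsimp only at h hc
      obtain ⟨p, rfl⟩ := Multiset.card_eq_one.1 hc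
      obtain ⟨q, hq, e⟩ := h.exists_fst 0 (Nat.zero_le _)
      obtain ⟨r, hr, f⟩ := h.exists_snd 0 (Nat.zero_le _)
      rw [Multiset.mem_singleton] at hq hr
      rw [hq] at e
      rw [hr] at f
      obtain rfl : p = (0, 0) := Prod.ext e f
      obtain ⟨rfl, rfl⟩ := h.unique isFishburn_singleton
      rfl
  | succ n ih =>
    simp only [fishburnTriples, Finset.mem_biUnion, Finset.mem_image, Finset.mem_range]
    constructor
    · rintro ⟨S, hS, m, hm, rfl⟩
      obtain ⟨h, hc⟩ := ih.1 hS
      exact ⟨h.child hm, by rw [card_fishburnChild, hc]⟩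
    · rintro ⟨h, hc⟩
      obtain ⟨S, hS, hm, e⟩ := h.exists_parent (by omega)
      refine ⟨S, ih.2 ⟨hS, ?_⟩, _, hm, e⟩
      have := card_fishburnChild S T.2.2
      rw [e, hc] at this
      omega

theorem sum_fishburnTriples_eq_treeSum {A : Type*} [AddCommMonoid A] (n : ℕ) :
    ∀ g : ℕ → ℕ → A, ∑ T ∈ fishburnTriples n, g T.2.1 T.2.2 = treeSum n g := by
  induction n with
  | zero => intro g; simp [fishburnTriples, treeSum]
  | succ n ih =>
    intro g
    rw [treeSum, ← ih, fishburnTriples, Finset.sum_biUnion]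
    · refine Finset.sum_congr rfl fun T hT => ?_
      have h := (mem_fishburnTriples.1 hT).1
      rw [Finset.sum_image]
      · refine Finset.sum_congr rfl fun m _ => ?_
        unfold fishburnChild
        split_ifs <;> rfl
      · intro m hm m' _ e
        exact (fishburnChild_inj h h e).2
    · intro T hT T' hT' hne
      rw [Function.onFun, Finset.disjoint_left]
      intro S hS hS'
      obtain ⟨m, hm, rfl⟩ := Finset.mem_image.1 hS
      obtain ⟨m', hm', e⟩ := Finset.mem_image.1 hS'
      exact hne (fishburnChild_inj (mem_fishburnTriples.1 hT).1 (mem_fishburnTriples.1 hT').1 e.symm).1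

theorem card_fishburnTriples (n : ℕ) :
    (fishburnTriples n).card = (ascentSequences (n + 1)).card := by
  rw [Finset.card_eq_sum_ones, Finset.card_eq_sum_ones,
    sum_fishburnTriples_eq_treeSum n fun _ _ => 1, sum_ascentSequences_eq_treeSum n fun _ _ => 1]

/-! ### Canonical interval representations -/

/-- A function whose multiset of values is a Fishburn multiset. -/
structure IsFishburnFun {α : Type*} (f : α → ℕ × ℕ) (a : ℕ) : Prop where
  fst_le_snd : ∀ x, (f x).1 ≤ (f x).2
  snd_le : ∀ x, (f x).2 ≤ a
  exists_fst : ∀ i ≤ a, ∃ x, (f x).1 = i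
  exists_snd : ∀ j ≤ a, ∃ x, (f x).2 = j

/-- `x < y` exactly when the interval of `x` lies to the left of that of `y`. -/
def Represents {α : Type*} (f : α → ℕ × ℕ) (r : α → α → Prop) : Prop :=
  ∀ x y, r x y ↔ (f x).2 < (f y).1

section Uniqueness

variable {α : Type*} {r : α → α → Prop} {f g : α → ℕ × ℕ} {a b : ℕ}

/-- Induction on the left endpoint i + 1 of x: some z ends at i and some w starts at i, so z < x but
not z < w. In g this puts the start of w at or before the end of z, hence strictly before the start
of x. -/
theorem fst_le_fst_of_represents (hf : IsFishburnFun f a)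
    (rf : Represents f r) (rg : Represents g r) (x : α) : (f x).1 ≤ (g x).1 := by
  induction hi : (f x).1 generalizing x with
  | zero => exact Nat.zero_le _
  | succ i ih =>
    have hia : i + 1 ≤ a := hi ▸ (hf.fst_le_snd x).trans (hf.snd_le x)
    obtain ⟨z, hz⟩ := hf.exists_snd i (by omega)
    obtain ⟨w, hw⟩ := hf.exists_fst i (by omega)
    have h1 : (g z).2 < (g x).1 := (rg z x).1 ((rf z x).2 (by omega))
    have h2 : ¬ (g z).2 < (g w).1 := fun h => by
      have := (rf z w).1 ((rg z w).2 h)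
      omega
    have h3 := ih w hw
    omega

theorem snd_le_snd_of_represents (hf : IsFishburnFun f a)
    (rf : Represents f r) (rg : Represents g r) (x : α) : (f x).2 ≤ (g x).2 := by
  obtain ⟨w, hw⟩ := hf.exists_fst _ (hf.snd_le x)
  have h1 := fst_le_fst_of_represents hf rf rg w
  have h2 : ¬ (g x).2 < (g w).1 := fun h => by
    have := (rf x w).1 ((rg x w).2 h)
    omega
  omega

theorem eq_of_represents (hf : IsFishburnFun f a) (hg : IsFishburnFun g b)
    (rf : Represents f r) (rg : Represents g r) : f = g := by
  funext x
  exact Prod.ext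
    (le_antisymm (fst_le_fst_of_represents hf rf rg x)
      (fst_le_fst_of_represents hg rg rf x))
    (le_antisymm (snd_le_snd_of_represents hf rf rg x)
      (snd_le_snd_of_represents hg rg rf x))

end Uniqueness

theorem IsFishburnFun.comp_equiv {α β : Type*} {f : α → ℕ × ℕ} {a : ℕ} (hf : IsFishburnFun f a)
    (e : β ≃ α) : IsFishburnFun (fun x => f (e x)) a where
  fst_le_snd x := hf.fst_le_snd _
  snd_le x := hf.snd_le _
  exists_fst i hi := by
    obtain ⟨x, hx⟩ := hf.exists_fst i hi
    exact ⟨e.symm x, by simpa using hx⟩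
  exists_snd j hj := by
    obtain ⟨x, hx⟩ := hf.exists_snd j hj
    exact ⟨e.symm x, by simpa using hx⟩

theorem isTwoPlusTwoFree_iff {α : Type*} [PartialOrder α] :
    IsTwoPlusTwoFree α ↔ ∀ a b c d : α, a < b → c < d → a < d ∨ c < b := by
  constructor
  · intro h a b c d hab hcd
    by_contra! hc
    obtain ⟨had, hcb⟩ := hc
    have e1 : ¬ a ≤ c := fun h => had (h.trans_lt hcd)
    have e2 : ¬ c ≤ a := fun h => hcb (h.trans_lt hab)
    have e3 : ¬ b ≤ d := fun h => had (hab.trans_le h)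
    have e4 : ¬ d ≤ b := fun h => hcb (hcd.trans_le h)
    have e5 : ¬ b ≤ c := fun h => had (hab.trans_le (h.trans hcd.le))
    have e6 : ¬ d ≤ a := fun h => hcb (hcd.trans_le (h.trans hab.le))
    have e7 : ¬ a ≤ d := fun h => (lt_or_eq_of_le h).elim had fun h => e6 h.ge
    have e8 : ¬ c ≤ b := fun h => (lt_or_eq_of_le h).elim hcb fun h => e5 h.ge
    refine h.false (OrderEmbedding.ofMapLEIff (Sum.elim ![a, b] ![c, d]) ?_)
    rintro (i | i) (j | j) <;> fin_cases i <;> fin_cases j <;>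
      simp [hab.le, hcd.le, hab.not_ge, hcd.not_ge, e1, e2, e3, e4, e5, e6, e7, e8]
  · refine fun h => ⟨fun f => ?_⟩
    have h1 : f (Sum.inl 0) < f (Sum.inl 1) := by simp
    have h2 : f (Sum.inr 0) < f (Sum.inr 1) := by simp
    rcases h _ _ _ _ h1 h2 with h3 | h3 <;> simp at h3

theorem exists_count_eq {p : ℕ → Prop} [DecidablePred p] {v i : ℕ} (hv : p v)
    (hi : i ≤ Nat.count p v) : ∃ w, p w ∧ Nat.count p w = i := by
  rcases hi.eq_or_lt with rfl | hi
  · exact ⟨v, hv, rfl⟩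
  · have hlt : ∀ hf : (Set.ofPred p).Finite, i < hf.toFinset.card := fun hf =>
      hi.trans (Nat.count_lt_card hf hv)
    exact ⟨Nat.nth p i, Nat.nth_mem i hlt, Nat.count_nth hlt⟩

/-- Strict down-sets in a (2+2)-free order form a chain, so their sizes D order them. An element x
becomes the interval from D x to τ x, the largest D z with x not below z; replacing values by ranks
among the values of D removes the gaps. -/
theorem exists_represents {α : Type*} [Fintype α] [Nonempty α] [PartialOrder α]
    (h : IsTwoPlusTwoFree α) :
    ∃ (f : α → ℕ × ℕ) (a : ℕ), IsFishburnFun f a ∧ Represents f (· < ·) := by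
  classical
  rw [isTwoPlusTwoFree_iff] at h
  let D : α → ℕ := fun y => (Finset.univ.filter (· < y)).card
  have hD : ∀ y z, D y ≤ D z → ∀ x, x < y → x < z := by
    intro y z hyz x hxy
    by_contra hxz
    refine (Finset.card_lt_card ?_).not_ge hyz
    rw [Finset.ssubset_iff_of_subset]
    · exact ⟨x, by simpa using hxy, by simpa using hxz⟩
    · intro w hw
      have hw' : w < z := by simpa using hw
      simpa using (h x y w z hxy hw').resolve_left hxz
  have hD' : ∀ y z, D y < D z → ∃ x, x < z ∧ ¬ x < y := by
    intro y z hyz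
    by_contra! hc
    refine (Finset.card_le_card ?_).not_gt hyz
    intro x hx
    simpa using hc x (by simpa using hx)
  let τ : α → ℕ := fun x => (Finset.univ.filter fun z => ¬ x < z).sup D
  have hτ : ∀ x z, ¬ x < z → D z ≤ τ x := fun x z hxz =>
    Finset.le_sup (f := D) (by simpa using hxz)
  have hτ' : ∀ x, ∃ z, ¬ x < z ∧ D z = τ x := by
    intro x
    obtain ⟨z, hz, e⟩ := Finset.exists_mem_eq_sup (Finset.univ.filter fun z => ¬ x < z)
      ⟨x, by simp⟩ D
    exact ⟨z, by simpa using hz, e.symm⟩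
  have hlt : ∀ x y, x < y ↔ τ x < D y := by
    refine fun x y => ⟨fun hxy => ?_, fun hxy => ?_⟩
    · obtain ⟨z, hz, e⟩ := hτ' x
      rw [← e]
      by_contra! hle
      exact hz (hD y z hle x hxy)
    · by_contra hn
      exact (hτ x y hn).not_gt hxy
  obtain ⟨m, -, hm⟩ := Finset.exists_max_image Finset.univ D Finset.univ_nonempty
  let p : ℕ → Prop := fun v => ∃ y, D y = v
  have hpD : ∀ y, p (D y) := fun y => ⟨y, rfl⟩
  have hpτ : ∀ x, p (τ x) := fun x => (hτ' x).imp fun z hz => hz.2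
  have hDτ : ∀ x, D x ≤ τ x := fun x => hτ x x (lt_irrefl x)
  have hτm : ∀ x, τ x ≤ D m := by
    intro x
    obtain ⟨z, -, e⟩ := hτ' x
    exact e ▸ hm z (Finset.mem_univ z)
  have hmono := Nat.count_monotone p
  have hrow : ∀ i ≤ Nat.count p (D m), ∃ y, Nat.count p (D y) = i := by
    intro i hi
    obtain ⟨_, ⟨y, rfl⟩, e⟩ := exists_count_eq (hpD m) hi
    exact ⟨y, e⟩
  refine ⟨fun x => (Nat.count p (D x), Nat.count p (τ x)), Nat.count p (D m),
    ⟨fun x => hmono (hDτ x), fun x => hmono (hτm x), hrow, ?_⟩, ?_⟩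
  · intro j hj
    rcases hj.eq_or_lt with rfl | hj
    · exact ⟨m, by dsimp only; rw [le_antisymm (hτm m) (hDτ m)]⟩
    · obtain ⟨y, hy⟩ := hrow j hj.le
      obtain ⟨y', hy'⟩ := hrow (j + 1) hj
      -- For consecutive ranks j and j + 1, an x below y' but not below y has D y ≤ τ x < D y', so τ
      -- x has rank j.
      have hyy : D y < D y' := by
        by_contra! hle
        have := hmono hle
        omega
      obtain ⟨x, hx, hxy⟩ := hD' y y' hyy
      have h1 := hmono (hτ x y hxy)
      have h2 := Nat.count_strict_mono (hpτ x) ((hlt x y').1 hx)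
      refine ⟨x, ?_⟩
      dsimp only
      omega
  · intro x y
    change x < y ↔ Nat.count p (τ x) < Nat.count p (D y)
    rw [hlt]
    exact ⟨fun hxy => Nat.count_strict_mono (hpτ x) hxy, fun hxy => hmono.reflect_lt hxy⟩

/-- The interval order of a family of intervals. -/
abbrev intervalOrder {α : Type*} (f : α → ℕ × ℕ) (h : ∀ x, (f x).1 ≤ (f x).2) :
    PartialOrder α where
  le x y := x = y ∨ (f x).2 < (f y).1
  lt x y := (f x).2 < (f y).1
  le_refl x := Or.inl rfl
  le_trans x y z := by
    rintro (rfl | hxy) (rfl | hyz)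
    · exact Or.inl rfl
    · exact Or.inr hyz
    · exact Or.inr hxy
    · exact Or.inr (hxy.trans ((h y).trans_lt hyz))
  le_antisymm x y := by
    rintro (rfl | hxy) (hyx | hyx)
    · rfl
    · rfl
    · exact hyx.symm
    · have := h x
      have := h y
      omega
  lt_iff_le_not_ge x y := by
    have h1 := h x
    have h2 := h y
    constructor
    · refine fun hxy => ⟨Or.inr hxy, ?_⟩
      rintro (rfl | hyx) <;> omega
    · rintro ⟨rfl | hxy, hn⟩
      · exact absurd (Or.inl rfl) hn
      · exact hxy

theorem isTwoPlusTwoFree_intervalOrder {α : Type*} (f : α → ℕ × ℕ) (h : ∀ x, (f x).1 ≤ (f x).2) :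
    @IsTwoPlusTwoFree α (intervalOrder f h) := by
  let _ := intervalOrder f h
  rw [isTwoPlusTwoFree_iff]
  intro a b c d hab hcd
  change (f a).2 < (f b).1 at hab
  change (f c).2 < (f d).1 at hcd
  change (f a).2 < (f d).1 ∨ (f c).2 < (f b).1
  omega

theorem nonempty_orderIso_iff {α β : Type*} [PartialOrder α] [PartialOrder β] :
    Nonempty (α ≃o β) ↔ ∃ e : α ≃ β, ∀ x y, x < y ↔ e x < e y := by
  constructor
  · rintro ⟨e⟩
    exact ⟨e.toEquiv, fun x y => e.lt_iff_lt.symm⟩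
  · rintro ⟨e, he⟩
    refine ⟨⟨e, fun {x y} => ?_⟩⟩
    rw [le_iff_lt_or_eq, le_iff_lt_or_eq, ← he, e.injective.eq_iff]

/-! ### Isomorphism classes as Fishburn multisets -/

theorem exists_represents_order {n : ℕ} (P : TwoPlusTwoFreeOrder (n + 1)) :
    ∃ (f : Fin (n + 1) → ℕ × ℕ) (a : ℕ), IsFishburnFun f a ∧ Represents f P.1.lt :=
  @exists_represents (Fin (n + 1)) _ _ P.1 P.2

/-- The canonical interval representation of a `(2+2)`-free order. -/
def canonicalRep {n : ℕ} (P : TwoPlusTwoFreeOrder (n + 1)) : Fin (n + 1) → ℕ × ℕ :=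
  (exists_represents_order P).choose

theorem exists_isFishburnFun_canonicalRep {n : ℕ} (P : TwoPlusTwoFreeOrder (n + 1)) :
    ∃ a, IsFishburnFun (canonicalRep P) a :=
  (exists_represents_order P).choose_spec.imp fun _ h => h.1

theorem represents_canonicalRep {n : ℕ} (P : TwoPlusTwoFreeOrder (n + 1)) :
    Represents (canonicalRep P) P.1.lt :=
  (exists_represents_order P).choose_spec.choose_spec.2

theorem map_univ_val_eq_map_univ_val_iff {α A : Type*} [Fintype α] (f g : α → A) :
    Finset.univ.val.map f = Finset.univ.val.map g ↔ ∃ e : Equiv.Perm α, ∀ x, f x = g (e x) := by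
  classical
  constructor
  · intro h
    have hcard : ∀ c, Nonempty ({x // f x = c} ≃ {x // g x = c}) := by
      intro c
      rw [← Fintype.card_eq, Fintype.card_subtype, Fintype.card_subtype]
      have := congrArg (Multiset.count c) h
      rw [Multiset.count_map, Multiset.count_map] at this
      simpa [Finset.card_def, eq_comm] using this
    let e := fun c => (hcard c).some
    exact ⟨Equiv.ofFiberEquiv e, fun x => (Equiv.ofFiberEquiv_map e x).symm⟩
  · rintro ⟨e, h⟩
    obtain rfl : f = g ∘ e := funext h
    rw [← Multiset.map_map, Multiset.map_univ_val_equiv]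

/-- A permutation matching the intervals preserves the order they define. Conversely, pulling back
the representation of Q along an isomorphism represents P, and uniqueness applies. -/
theorem map_canonicalRep_eq_iff {n : ℕ} (P Q : TwoPlusTwoFreeOrder (n + 1)) :
    Finset.univ.val.map (canonicalRep P) = Finset.univ.val.map (canonicalRep Q) ↔
      twoPlusTwoFreeSetoid (n + 1) P Q := by
  have hiso : twoPlusTwoFreeSetoid (n + 1) P Q ↔
      ∃ e : Equiv.Perm (Fin (n + 1)), ∀ x y, P.1.lt x y ↔ Q.1.lt (e x) (e y) :=
    @nonempty_orderIso_iff _ _ P.1 Q.1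
  rw [hiso, map_univ_val_eq_map_univ_val_iff]
  refine exists_congr fun e => ⟨fun h x y => ?_, fun h => ?_⟩
  · rw [represents_canonicalRep P x y, represents_canonicalRep Q (e x) (e y), h, h]
  · obtain ⟨a, ha⟩ := exists_isFishburnFun_canonicalRep P
    obtain ⟨b, hb⟩ := exists_isFishburnFun_canonicalRep Q
    refine congrFun (eq_of_represents ha (hb.comp_equiv e) (represents_canonicalRep P) fun x y => ?_)
    rw [h, represents_canonicalRep Q (e x) (e y)]

theorem exists_isFishburn_map_iff {α : Type*} [Fintype α] (f : α → ℕ × ℕ) (a : ℕ) :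
    (∃ l, IsFishburn (Finset.univ.val.map f) a l) ↔ IsFishburnFun f a := by
  constructor
  · rintro ⟨l, h⟩
    exact ⟨fun x => h.fst_le_snd _ (by simp), fun x => h.snd_le _ (by simp),
      fun i hi => by simpa using h.exists_fst i hi, fun j hj => by simpa using h.exists_snd j hj⟩
  · intro h
    refine exists_isFishburn ?_ (fun i hi => ?_) fun j hj => ?_
    · intro p hp
      obtain ⟨x, -, rfl⟩ := Multiset.mem_map.1 hp
      exact ⟨h.fst_le_snd x, h.snd_le x⟩
    · simpa using h.exists_fst i hi
    · simpa using h.exists_snd j hj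

theorem exists_map_univ_eq {A : Type*} {n : ℕ} (M : Multiset A) (hM : Multiset.card M = n) :
    ∃ f : Fin n → A, Finset.univ.val.map f = M := by
  obtain ⟨L, rfl⟩ := Quot.exists_rep M
  change L.length = n at hM
  subst hM
  exact ⟨L.get, by rw [Fin.univ_val_map, List.ofFn_get]; rfl⟩

theorem mem_image_fst_fishburnTriples {n : ℕ} {M : Multiset (ℕ × ℕ)} :
    M ∈ (fishburnTriples n).image Prod.fst ↔
      (∃ a l, IsFishburn M a l) ∧ Multiset.card M = n + 1 := by
  simp only [Finset.mem_image, Prod.exists, exists_and_right, exists_eq_right,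
    mem_fishburnTriples]

theorem numTwoPlusTwoFree_succ (n : ℕ) :
    numTwoPlusTwoFree (n + 1) = (fishburnTriples n).card := by
  have hinj : ((fishburnTriples n).image Prod.fst).card = (fishburnTriples n).card := by
    refine Finset.card_image_of_injOn ?_
    rintro ⟨M, a, l⟩ h ⟨M', a', l'⟩ h' (rfl : M = M')
    obtain ⟨rfl, rfl⟩ := (mem_fishburnTriples.1 h).1.unique (mem_fishburnTriples.1 h').1
    rfl
  rw [← hinj, ← Fintype.card_coe, ← Nat.card_eq_fintype_card, numTwoPlusTwoFree]
  have hmem : ∀ P : TwoPlusTwoFreeOrder (n + 1),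
      Finset.univ.val.map (canonicalRep P) ∈ (fishburnTriples n).image Prod.fst := by
    intro P
    obtain ⟨a, ha⟩ := exists_isFishburnFun_canonicalRep P
    exact mem_image_fst_fishburnTriples.2 ⟨⟨a, (exists_isFishburn_map_iff _ _).2 ha⟩, by simp⟩
  refine Nat.card_eq_of_bijective
    (Quotient.lift (fun P => (⟨_, hmem P⟩ : {M // M ∈ (fishburnTriples n).image Prod.fst}))
      fun P Q h => Subtype.ext ((map_canonicalRep_eq_iff P Q).2 h)) ⟨?_, ?_⟩
  · rintro ⟨P⟩ ⟨Q⟩ h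
    exact Quotient.sound ((map_canonicalRep_eq_iff P Q).1 (congrArg Subtype.val h))
  · rintro ⟨M, hM⟩
    obtain ⟨⟨a, l, h⟩, hc⟩ := mem_image_fst_fishburnTriples.1 hM
    obtain ⟨f, rfl⟩ := exists_map_univ_eq M hc
    have hf := (exists_isFishburn_map_iff f a).1 ⟨l, h⟩
    let P : TwoPlusTwoFreeOrder (n + 1) :=
      ⟨intervalOrder f hf.fst_le_snd, isTwoPlusTwoFree_intervalOrder f hf.fst_le_snd⟩
    refine ⟨Quotient.mk _ P, Subtype.ext ?_⟩
    change Finset.univ.val.map (canonicalRep P) = _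
    obtain ⟨b, hb⟩ := exists_isFishburnFun_canonicalRep P
    -- By definition f represents its own interval order, so uniqueness makes it the canonical
    -- representation.
    rw [eq_of_represents hb hf (represents_canonicalRep P) fun x y => Iff.rfl]

theorem numTwoPlusTwoFree_zero : numTwoPlusTwoFree 0 = 1 := by
  rw [numTwoPlusTwoFree, Nat.card_eq_one_iff_unique]
  constructor
  · refine ⟨fun p q => ?_⟩
    induction p using Quotient.inductionOn with | _ P =>
    induction q using Quotient.inductionOn with | _ Q =>
    exact Quotient.sound ((@nonempty_orderIso_iff _ _ P.1 Q.1).2 ⟨Equiv.refl _, fun x => x.elim0⟩)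
  · have h : ∀ x : Fin 0, ((fun _ => (0, 0) : Fin 0 → ℕ × ℕ) x).1 ≤
        ((fun _ => (0, 0) : Fin 0 → ℕ × ℕ) x).2 := fun x => x.elim0
    exact ⟨Quotient.mk _ ⟨intervalOrder _ h, isTwoPlusTwoFree_intervalOrder _ h⟩⟩

theorem numTwoPlusTwoFree_eq_card (n : ℕ) :
    numTwoPlusTwoFree n = (ascentSequences n).card := by
  rcases n with _ | n
  · rw [numTwoPlusTwoFree_zero, ascentSequences_zero, Finset.card_singleton]
  · rw [numTwoPlusTwoFree_succ, card_fishburnTriples]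

end

theorem theorem6p5 :
    (∀ n : ℕ, (Polynomial.X : ℚ[X][X]) ^ n ∣ Fpoly n) ∧
    HasFormalSum (fun n : ℕ => (Fpoly n : ℚ[X]⟦X⟧)) ascentGF ∧
    (∀ n : ℕ, (Fpoly n).map (Polynomial.evalRingHom (1 : ℚ)) =
      ∏ i ∈ Finset.Icc 1 n, (1 - (1 - (Polynomial.X : ℚ[X])) ^ i)) ∧
    HasFormalSum
      (fun n : ℕ => ∏ i ∈ Finset.Icc 1 n, (1 - (1 - (PowerSeries.X : ℚ⟦X⟧)) ^ i)) posetGF := by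
  refine ⟨X_pow_dvd_Fpoly, hasFormalSum_Fpoly, Fpoly_map_eval_one, hasFormalSum_prod fun n => ?_⟩
  rw [posetGF, PowerSeries.coeff_mk, numTwoPlusTwoFree_eq_card]
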